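/- Let $\mathcal H$ be a complex Hilbert space with an orthonormal basis $(e_n)_{n\ge 0}$, and let $S$ be a unilateral weighted shift on $\mathcal H$ with a bounded sequence of positive weights $(\omega_n)_{n\ge 0}$, i.e. the bounded linear operator with $Se_n=\omega_n e_{n+1}$ for all $n\ge 0$. Put $\beta_0=1$ and $\beta_n=\omega_0\cdots\omega_{n-1}$ for $n\ge 1$. For $x\in\mathcal H$, let the local resolvent set $\rho_S(x)$ be the union of all open sets $U\subset\mathbb C$ on which there is an analytic function $f:U\to\mathcal H$ with $(S-\lambda)f(\lambda)=x$ for all $\lambda\in U$, and let $\sigma_S(x)=\mathbb C\setminus\rho_S(x)$ be the local spectrum of $S$ at $x$. Suppose that $S$ satisfies Dunford's condition (C): for every closed set $F\subset\mathbb C$, the linear subspace $\{x\in\mathcal H:\sigma_S(x)\subset F\}$ is closed in $\mathcal H$. Then the spectral radius $r(S)$ of $S$ is $$r(S)=r_3(S):=\limsup_{n\to\infty}\beta_n^{1/n}.$$ -/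

import Mathlib

open Filter

noncomputable section

/-- The local resolvent set of `T` at `x`: the union of all open sets `U` on which there is an
analytic vector-valued function `f` with `(T - z) f(z) = x` for all `z ∈ U`. -/
def localResolventSet {H : Type*} [NormedAddCommGroup H] [InnerProductSpace ℂ H]
    (T : H →L[ℂ] H) (x : H) : Set ℂ :=
  ⋃₀ {U : Set ℂ | IsOpen U ∧
    ∃ f : ℂ → H, AnalyticOnNhd ℂ f U ∧ ∀ z ∈ U, T (f z) - z • f z = x}

/-- The local spectrum of `T` at `x`. -/
def localSpectrum {H : Type*} [NormedAddCommGroup H] [InnerProductSpace ℂ H]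
    (T : H →L[ℂ] H) (x : H) : Set ℂ :=
  (localResolventSet T x)ᶜ

/-- The analytic spectral subspace of `T` associated with `F` (as a set of vectors). -/
def analyticSpectralSubspace {H : Type*} [NormedAddCommGroup H] [InnerProductSpace ℂ H]
    (T : H →L[ℂ] H) (F : Set ℂ) : Set H :=
  {x : H | localSpectrum T x ⊆ F}

/-- Dunford's condition (C): the analytic spectral subspace of every closed set is closed. -/
def DunfordConditionC {H : Type*} [NormedAddCommGroup H] [InnerProductSpace ℂ H]
    (T : H →L[ℂ] H) : Prop :=
  ∀ F : Set ℂ, IsClosed F → IsClosed (analyticSpectralSubspace T F)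

/-- `S` is the unilateral weighted shift with positive weights `ω` with respect to the
orthonormal basis `e`. Boundedness of `ω` is automatic, because `S` is a bounded operator
and `‖S (e n)‖ = ω n`. -/
structure IsUnilateralWeightedShift {H : Type*} [NormedAddCommGroup H] [InnerProductSpace ℂ H]
    (e : HilbertBasis ℕ ℂ H) (ω : ℕ → ℝ) (S : H →L[ℂ] H) : Prop where
  weight_pos : ∀ n, 0 < ω n
  apply_basis : ∀ n, S (e n) = (ω n : ℂ) • e (n + 1)

/-- `β₀ = 1` and `βₙ = ω₀ ⋯ ωₙ₋₁`. -/
def weightProd (ω : ℕ → ℝ) (n : ℕ) : ℝ := ∏ i ∈ Finset.range n, ω i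

/-- `r₃ = limsup βₙ^(1/n)`, taken in `[0, ∞]`, like Mathlib's spectral radius. -/
def shiftR3 (ω : ℕ → ℝ) : ENNReal :=
  limsup (fun n : ℕ => ENNReal.ofReal (weightProd ω n ^ (1 / (n : ℝ)))) atTop

end

/-!
For a cyclic vector `x` of `T` put `r = limsup ‖Tⁿ x‖^(1/n)`. The Neumann series `-∑ z⁻ⁿ⁻¹ Tⁿ x`
shows that the local spectrum of `T` at `x` lies in the closed disc of radius `r`. The analytic
spectral subspace of this disc is `T`-invariant and contains `x`, and condition (C) makes it closed,
so it is the whole space; hence `T - z` is surjective for `|z| > r`. A nonzero spectral value of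
maximal modulus is a limit of points of the resolvent set, and a surjective limit of invertible
operators is invertible, so the spectral radius is at most `r`. The reverse inequality is Gelfand's
formula. For the weighted shift, `Sⁿ e₀ = βₙ eₙ`, so `e₀` is cyclic and `r = r₃`.
-/

open scoped ENNReal Topology

section SurjectiveLimit

variable {𝕜 E : Type*} [NontriviallyNormedField 𝕜] [NormedAddCommGroup E] [NormedSpace 𝕜 E]

-- When `‖A - B‖ * C < 1` the last term can be absorbed, so `B⁻¹` stays bounded as `B → A`.
theorem norm_units_inv_le {A : E →L[𝕜] E} {C : ℝ} (hC : 0 ≤ C)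
    (hA : ∀ y, ∃ u, A u = y ∧ ‖u‖ ≤ C * ‖y‖) (B : (E →L[𝕜] E)ˣ) :
    ‖(↑B⁻¹ : E →L[𝕜] E)‖ ≤ C + ‖(↑B⁻¹ : E →L[𝕜] E)‖ * ‖A - B‖ * C := by
  refine ContinuousLinearMap.opNorm_le_bound _ (by positivity) fun y => ?_
  obtain ⟨u, rfl, hu⟩ := hA y
  have h_split : (↑B⁻¹ : E →L[𝕜] E) (A u) = u + (↑B⁻¹ : E →L[𝕜] E) ((A - B) u) := by
    have h_cancel : (↑B⁻¹ : E →L[𝕜] E) ((B : E →L[𝕜] E) u) = u :=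
      DFunLike.congr_fun B.inv_mul u
    simp only [sub_apply, map_sub, h_cancel, add_sub_cancel]
  calc ‖(↑B⁻¹ : E →L[𝕜] E) (A u)‖
      ≤ ‖u‖ + ‖(↑B⁻¹ : E →L[𝕜] E)‖ * (‖A - B‖ * ‖u‖) := by
        rw [h_split]
        exact norm_add_le_of_le le_rfl
          (ContinuousLinearMap.le_opNorm_of_le _ (ContinuousLinearMap.le_opNorm _ _))
    _ = (1 + ‖(↑B⁻¹ : E →L[𝕜] E)‖ * ‖A - B‖) * ‖u‖ := by ring
    _ ≤ (1 + ‖(↑B⁻¹ : E →L[𝕜] E)‖ * ‖A - B‖) * (C * ‖A u‖) := by gcongr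
    _ = (C + ‖(↑B⁻¹ : E →L[𝕜] E)‖ * ‖A - B‖ * C) * ‖A u‖ := by ring

theorem isUnit_of_surjective_of_mem_closure [CompleteSpace E] {A : E →L[𝕜] E}
    (hsurj : Function.Surjective A) (hA : A ∈ closure {B : E →L[𝕜] E | IsUnit B}) : IsUnit A := by
  obtain ⟨C, hC, hpre⟩ := A.exists_preimage_norm_le hsurj
  obtain ⟨_, ⟨B, rfl⟩, hB⟩ := Metric.mem_closure_iff.mp hA (1 / (2 * C)) (by positivity)
  rw [dist_eq_norm, lt_div_iff₀ (by positivity)] at hB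
  have hinv := norm_units_inv_le hC.le hpre B
  obtain hE | hE := subsingleton_or_nontrivial (E →L[𝕜] E)
  · exact isUnit_of_subsingleton A
  have hpos : 0 < ‖(↑B⁻¹ : E →L[𝕜] E)‖ := Units.norm_pos B⁻¹
  have hbound : ‖(↑B⁻¹ : E →L[𝕜] E)‖ ≤ 2 * C := by nlinarith
  have hlt : ‖A - B‖ < ‖(↑B⁻¹ : E →L[𝕜] E)‖⁻¹ := by
    rw [← one_div, lt_div_iff₀ hpos]
    exact (mul_le_mul_of_nonneg_left hbound (norm_nonneg _)).trans_lt hB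
  exact (B.ofNearby A hlt).isUnit

end SurjectiveLimit

section MaximumModulus

variable {𝕜 : Type*} [RCLike 𝕜]

theorem mem_closure_resolventSet_of_nnnorm_eq_spectralRadius {A : Type*} [NormedRing A]
    [NormedAlgebra 𝕜 A] {a : A} {z : 𝕜} (hz : z ≠ 0)
    (hmax : (‖z‖₊ : ℝ≥0∞) = spectralRadius 𝕜 a) : z ∈ closure (resolventSet 𝕜 a) := by
  have hsub : spectrum 𝕜 a ⊆ Metric.closedBall 0 ‖z‖ := fun w hw => by
    have hle : (‖w‖₊ : ℝ≥0∞) ≤ ‖z‖₊ := hmax ▸ le_iSup₂ (f := fun k _ => (‖k‖₊ : ℝ≥0∞)) w hw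
    simpa [← coe_nnnorm] using hle
  have hnot_interior : z ∉ interior (spectrum 𝕜 a) := fun h => by
    have hball := interior_mono hsub h
    rw [interior_closedBall _ (norm_ne_zero_iff.mpr hz)] at hball
    simp at hball
  rw [← compl_compl (resolventSet 𝕜 a), closure_compl]
  exact hnot_interior

theorem spectralRadius_le_of_surjective {E : Type*} [NormedAddCommGroup E] [NormedSpace 𝕜 E]
    [CompleteSpace E] {T : E →L[𝕜] E} {r : ℝ≥0∞}
    (hsurj : ∀ z : 𝕜, r < ‖z‖ₑ → Function.Surjective (algebraMap 𝕜 (E →L[𝕜] E) z - T)) :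
    spectralRadius 𝕜 T ≤ r := by
  by_contra! hr
  have hne : (spectrum 𝕜 T).Nonempty := by
    rw [Set.nonempty_iff_ne_empty]
    intro h
    simp [spectralRadius, h] at hr
  obtain ⟨z, hz, hmax⟩ := spectrum.exists_nnnorm_eq_spectralRadius_of_nonempty hne
  have hrz : r < ‖z‖ₑ := by rwa [← hmax] at hr
  have hz0 : z ≠ 0 := by
    rintro rfl
    simp at hrz
  have hcont : Continuous fun w : 𝕜 => algebraMap 𝕜 (E →L[𝕜] E) w - T := by fun_prop
  have hcl : algebraMap 𝕜 (E →L[𝕜] E) z - T ∈ closure {B : E →L[𝕜] E | IsUnit B} :=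
    map_mem_closure (f := fun w => algebraMap 𝕜 (E →L[𝕜] E) w - T) hcont
      (mem_closure_resolventSet_of_nnnorm_eq_spectralRadius hz0 hmax) fun _ hw => hw
  exact hz (isUnit_of_surjective_of_mem_closure (hsurj z hrz) hcl)

end MaximumModulus

section LocalSpectralRadius

variable {𝕜 E : Type*} [NontriviallyNormedField 𝕜] [NormedAddCommGroup E] [NormedSpace 𝕜 E]

/-- The local spectral radius of `T` at `x`, which bounds the local spectrum. It is `[0, ∞]`-valued,
as is `spectralRadius`; the term `n = 0` has the junk exponent `1 / 0 = 0`. -/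
noncomputable def localSpectralRadius (T : E →L[𝕜] E) (x : E) : ℝ≥0∞ :=
  limsup (fun n : ℕ => ‖(T ^ n) x‖ₑ ^ (1 / n : ℝ)) atTop

/-- The power series `∑ wⁿ Tⁿ x`, which represents `(1 - w T)⁻¹ x` near `w = 0`. -/
noncomputable def orbitSeries (T : E →L[𝕜] E) (x : E) : FormalMultilinearSeries 𝕜 𝕜 E :=
  fun n => ContinuousMultilinearMap.mkPiRing 𝕜 (Fin n) ((T ^ n) x)

theorem radius_orbitSeries (T : E →L[𝕜] E) (x : E) :
    (orbitSeries T x).radius = (localSpectralRadius T x)⁻¹ := by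
  have hnorm (n : ℕ) : ‖orbitSeries T x n‖₊ = ‖(T ^ n) x‖₊ :=
    NNReal.eq (ContinuousMultilinearMap.norm_mkPiRing _)
  rw [FormalMultilinearSeries.radius_eq_liminf, localSpectralRadius, ENNReal.inv_limsup]
  refine congrArg (liminf · atTop) (funext fun n => ?_)
  rw [hnorm, one_div, ENNReal.coe_rpow_of_nonneg _ (by positivity), enorm_eq_nnnorm]

theorem orbitSeries_sum_sub_smul_apply [CompleteSpace E] {T : E →L[𝕜] E} {x : E} {w : 𝕜}
    (hw : ‖w‖ₑ < (orbitSeries T x).radius) :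
    (orbitSeries T x).sum w - w • T ((orbitSeries T x).sum w) = x := by
  have hsum : HasSum (fun n : ℕ => w ^ n • (T ^ n) x) ((orbitSeries T x).sum w) := by
    simpa [orbitSeries] using (orbitSeries T x).hasSum (x := w) (by simpa using hw)
  have hshift : HasSum (fun n : ℕ => w ^ (n + 1) • (T ^ (n + 1)) x)
      (w • T ((orbitSeries T x).sum w)) := by
    convert (T.hasSum hsum).const_smul w using 2 with n
    rw [map_smul, smul_smul, ← pow_succ', pow_succ' T, mul_apply_eq_comp]
  have htail : HasSum (fun n : ℕ => w ^ (n + 1) • (T ^ (n + 1)) x)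
      ((orbitSeries T x).sum w - x) := by
    simpa using (hasSum_nat_add_iff' 1).mpr hsum
  rw [hshift.unique htail, sub_sub_cancel]

theorem localSpectralRadius_le_spectralRadius {E : Type*} [NormedAddCommGroup E]
    [NormedSpace ℂ E] [CompleteSpace E] (T : E →L[ℂ] E) (x : E) :
    localSpectralRadius T x ≤ spectralRadius ℂ T := by
  have hroot : Tendsto (fun n : ℕ => (1 + ‖x‖ₑ) ^ (1 / n : ℝ)) atTop (𝓝 1) := by
    have hroot' : Tendsto (fun n : ℕ => (1 + ‖x‖₊) ^ (1 / n : ℝ)) atTop (𝓝 1) := by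
      simpa using tendsto_const_nhds.nnrpow tendsto_one_div_atTop_nhds_zero_nat
        (.inl (by positivity : (1 + ‖x‖₊) ≠ 0))
    refine (ENNReal.tendsto_coe.mpr hroot').congr fun n => ?_
    rw [ENNReal.coe_rpow_of_nonneg _ (by positivity)]
    rfl
  have hprod := ENNReal.Tendsto.mul (spectrum.pow_nnnorm_pow_one_div_tendsto_nhds_spectralRadius T)
    (.inr ENNReal.one_ne_top) hroot (.inl one_ne_zero)
  rw [mul_one] at hprod
  refine hprod.limsup_eq ▸ limsup_le_limsup (.of_forall fun n => ?_)
  calc ‖(T ^ n) x‖ₑ ^ (1 / n : ℝ) ≤ (‖T ^ n‖ₑ * (1 + ‖x‖ₑ)) ^ (1 / n : ℝ) := by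
        gcongr
        exact ((T ^ n).le_opENorm x).trans (by gcongr; exact le_add_self)
    _ = _ := ENNReal.mul_rpow_of_nonneg _ _ (by positivity)

end LocalSpectralRadius

section AnalyticSpectralSubspace

variable {H : Type*} [NormedAddCommGroup H] [InnerProductSpace ℂ H] {T : H →L[ℂ] H} {x : H}

theorem exists_sub_apply_eq_of_notMem_localSpectrum {z : ℂ} (hz : z ∉ localSpectrum T x) :
    ∃ y, (algebraMap ℂ (H →L[ℂ] H) z - T) y = x := by
  obtain ⟨U, ⟨-, f, -, hfx⟩, hzU⟩ := Set.notMem_compl_iff.mp hz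
  refine ⟨-f z, ?_⟩
  rw [← hfx z hzU, map_neg, ← neg_apply, neg_sub]
  rfl

variable [CompleteSpace H]

theorem mem_localResolventSet_iff {z : ℂ} :
    z ∈ localResolventSet T x ↔
      ∃ f : ℂ → H, AnalyticAt ℂ f z ∧ ∀ᶠ w in 𝓝 z, T (f w) - w • f w = x := by
  constructor
  · rintro ⟨U, ⟨hU, f, hf, hfx⟩, hz⟩
    exact ⟨f, hf z hz, eventually_of_mem (hU.mem_nhds hz) hfx⟩
  · rintro ⟨f, hf, hfx⟩
    obtain ⟨U, hUsub, hU, hz⟩ := mem_nhds_iff.mp (hf.eventually_analyticAt.and hfx)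
    exact ⟨U, ⟨hU, f, fun w hw => (hUsub hw).1, fun w hw => (hUsub hw).2⟩, hz⟩

/-- The analytic spectral subspace of `T` associated with `F`, bundled as a submodule so that
inclusions in it can be checked on spanning sets. -/
def analyticSpectralSubmodule (T : H →L[ℂ] H) (F : Set ℂ) : Submodule ℂ H where
  carrier := analyticSpectralSubspace T F
  zero_mem' := Set.compl_subset_comm.mp fun z _ =>
    mem_localResolventSet_iff.mpr ⟨fun _ => 0, analyticAt_const, by simp⟩
  add_mem' := by
    intro x y hx hy
    refine Set.compl_subset_comm.mp fun z hz => ?_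
    obtain ⟨f, hf, hfx⟩ := mem_localResolventSet_iff.mp (Set.compl_subset_comm.mp hx hz)
    obtain ⟨g, hg, hgy⟩ := mem_localResolventSet_iff.mp (Set.compl_subset_comm.mp hy hz)
    refine mem_localResolventSet_iff.mpr ⟨f + g, hf.add hg, ?_⟩
    filter_upwards [hfx, hgy] with w hfw hgw
    rw [← hfw, ← hgw, Pi.add_apply, map_add, smul_add, add_sub_add_comm]
  smul_mem' := by
    intro c x hx
    refine Set.compl_subset_comm.mp fun z hz => ?_
    obtain ⟨f, hf, hfx⟩ := mem_localResolventSet_iff.mp (Set.compl_subset_comm.mp hx hz)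
    refine mem_localResolventSet_iff.mpr ⟨c • f, hf.const_smul, ?_⟩
    filter_upwards [hfx] with w hfw
    rw [← hfw, Pi.smul_apply, map_smul, smul_sub, smul_comm]

theorem localSpectrum_apply_subset (T : H →L[ℂ] H) (x : H) :
    localSpectrum T (T x) ⊆ localSpectrum T x := by
  refine Set.compl_subset_compl.mpr fun z hz => ?_
  obtain ⟨f, hf, hfx⟩ := mem_localResolventSet_iff.mp hz
  refine mem_localResolventSet_iff.mpr ⟨T ∘ f, (T.analyticAt _).comp hf, ?_⟩
  filter_upwards [hfx] with w hfw
  rw [← hfw, Function.comp_apply, map_sub, map_smul]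

theorem localSpectrum_pow_apply_subset (T : H →L[ℂ] H) (x : H) (n : ℕ) :
    localSpectrum T ((T ^ n) x) ⊆ localSpectrum T x := by
  induction n with
  | zero => rfl
  | succ n ih =>
    rw [pow_succ']
    exact (localSpectrum_apply_subset T _).trans ih

theorem enorm_le_localSpectralRadius_of_mem_localSpectrum {z : ℂ}
    (hz : z ∈ localSpectrum T x) : ‖z‖ₑ ≤ localSpectralRadius T x := by
  contrapose! hz
  rw [localSpectrum, Set.notMem_compl_iff, mem_localResolventSet_iff]
  have hz0 : z ≠ 0 := by
    rintro rfl
    simp at hz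
  have hinv : ‖z⁻¹‖ₑ < (orbitSeries T x).radius := by
    rwa [radius_orbitSeries, enorm_inv hz0, ENNReal.inv_lt_inv]
  have hsum : AnalyticAt ℂ (orbitSeries T x).sum z⁻¹ :=
    ((orbitSeries T x).hasFPowerSeriesOnBall (pos_of_gt hinv)).analyticAt_of_mem
      (by simpa using hinv)
  refine ⟨fun w => -(w⁻¹ • (orbitSeries T x).sum w⁻¹),
    ((analyticAt_inv hz0).smul (hsum.comp (analyticAt_inv hz0))).neg, ?_⟩
  have hnear : ∀ᶠ w : ℂ in 𝓝 z, ‖w⁻¹‖ₑ < (orbitSeries T x).radius :=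
    (continuousAt_inv₀ hz0).enorm.eventually_lt_const hinv
  filter_upwards [hnear, eventually_ne_nhds hz0] with w hw hw0
  rw [map_neg, map_smul, smul_neg, smul_inv_smul₀ hw0, sub_neg_eq_add, neg_add_eq_sub]
  exact orbitSeries_sum_sub_smul_apply hw

end AnalyticSpectralSubspace

/-- `x` is a cyclic vector of `T`: the span of its orbit under `T` is dense. -/
def IsCyclicVector {𝕜 E : Type*} [NontriviallyNormedField 𝕜] [NormedAddCommGroup E]
    [NormedSpace 𝕜 E] (T : E →L[𝕜] E) (x : E) : Prop :=
  Dense (Submodule.span 𝕜 (Set.range fun n : ℕ => (T ^ n) x) : Set E)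

theorem DunfordConditionC.localSpectrum_subset_of_isCyclicVector {H : Type*}
    [NormedAddCommGroup H] [InnerProductSpace ℂ H] [CompleteSpace H] {T : H →L[ℂ] H} {x : H}
    {F : Set ℂ} (hC : DunfordConditionC T) (hx : IsCyclicVector T x) (hF : IsClosed F)
    (hxF : localSpectrum T x ⊆ F) (y : H) : localSpectrum T y ⊆ F := by
  have hspan : Submodule.span ℂ (Set.range fun n : ℕ => (T ^ n) x) ≤
      analyticSpectralSubmodule T F :=
    Submodule.span_le.mpr <| Set.range_subset_iff.mpr fun n =>
      (localSpectrum_pow_apply_subset T x n).trans hxF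
  exact closure_minimal hspan (hC F hF) (hx y)

theorem theorem3_general {H : Type*} [NormedAddCommGroup H] [InnerProductSpace ℂ H]
    [CompleteSpace H] {T : H →L[ℂ] H} {x : H} (hx : IsCyclicVector T x)
    (hC : DunfordConditionC T) : spectralRadius ℂ T = localSpectralRadius T x := by
  refine le_antisymm (spectralRadius_le_of_surjective fun z hz y => ?_)
    (localSpectralRadius_le_spectralRadius T x)
  have hclosed : IsClosed {w : ℂ | ‖w‖ₑ ≤ localSpectralRadius T x} :=
    isClosed_le continuous_enorm continuous_const
  have hy : localSpectrum T y ⊆ {w | ‖w‖ₑ ≤ localSpectralRadius T x} :=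
    hC.localSpectrum_subset_of_isCyclicVector hx hclosed
      (fun _ => enorm_le_localSpectralRadius_of_mem_localSpectrum) y
  exact exists_sub_apply_eq_of_notMem_localSpectrum fun hzy => hz.not_ge (hy hzy)

theorem weightProd_pos {ω : ℕ → ℝ} (hω : ∀ n, 0 < ω n) (n : ℕ) : 0 < weightProd ω n :=
  Finset.prod_pos fun i _ => hω i

namespace IsUnilateralWeightedShift

variable {H : Type*} [NormedAddCommGroup H] [InnerProductSpace ℂ H]
  {e : HilbertBasis ℕ ℂ H} {ω : ℕ → ℝ} {S : H →L[ℂ] H}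

theorem pow_apply_basis_zero (hS : IsUnilateralWeightedShift e ω S) (n : ℕ) :
    (S ^ n) (e 0) = (weightProd ω n : ℂ) • e n := by
  induction n with
  | zero => simp [weightProd]
  | succ n ih =>
    rw [pow_succ', mul_apply_eq_comp, ih, map_smul, hS.apply_basis, smul_smul, weightProd,
      weightProd, Finset.prod_range_succ, Complex.ofReal_mul]

theorem isCyclicVector_basis_zero (hS : IsUnilateralWeightedShift e ω S) :
    IsCyclicVector S (e 0) := by
  have hspan : Submodule.span ℂ (Set.range e) ≤
      Submodule.span ℂ (Set.range fun n : ℕ => (S ^ n) (e 0)) := by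
    refine Submodule.span_le.mpr (Set.range_subset_iff.mpr fun n => ?_)
    have hβ : (weightProd ω n : ℂ) ≠ 0 :=
      Complex.ofReal_ne_zero.mpr (weightProd_pos hS.weight_pos n).ne'
    rw [← inv_smul_smul₀ hβ (e n), ← hS.pow_apply_basis_zero]
    exact Submodule.smul_mem _ _ (Submodule.subset_span ⟨n, rfl⟩)
  exact (Submodule.dense_iff_topologicalClosure_eq_top.mpr e.dense_span).mono hspan

theorem localSpectralRadius_basis_zero (hS : IsUnilateralWeightedShift e ω S) :
    localSpectralRadius S (e 0) = shiftR3 ω := by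
  refine congrArg (limsup · atTop) (funext fun n => ?_)
  have hβ := (weightProd_pos hS.weight_pos n).le
  have hnorm : ‖(S ^ n) (e 0)‖ = weightProd ω n := by
    rw [hS.pow_apply_basis_zero, norm_smul, e.orthonormal.1, mul_one, Complex.norm_of_nonneg hβ]
  rw [← ofReal_norm, hnorm, ENNReal.ofReal_rpow_of_nonneg hβ (by positivity)]

end IsUnilateralWeightedShift

theorem theorem3 {H : Type*} [NormedAddCommGroup H] [InnerProductSpace ℂ H] [CompleteSpace H]
    (e : HilbertBasis ℕ ℂ H) (ω : ℕ → ℝ) (S : H →L[ℂ] H)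
    (hS : IsUnilateralWeightedShift e ω S) (hC : DunfordConditionC S) :
    spectralRadius ℂ S = shiftR3 ω :=
  (theorem3_general hS.isCyclicVector_basis_zero hC).trans hS.localSpectralRadius_basis_zero
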